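/- Let $\mathcal X$ be a complex linear space and $\varphi=\{\varphi_k\}_{k=1}^\infty$ a linearly independent system in it. Suppose a number $(x,y)\in\mathbb C$ is given for all $x,y\in\mathcal X$ at least one of which belongs to $\varphi$, such that $(x,y)=\overline{(y,x)}$, $(\lambda x_1+\mu x_2,y)=\lambda(x_1,y)+\mu(x_2,y)$, and $(\varphi_k,\varphi_l)=1$ if $k=l$, $0$ otherwise. Put $\hat x(k)=(x,\varphi_k)$. For $p\in[1,\infty)$ let $\mathcal S^p_\varphi$ be the normed space of all $x\in\mathcal X$ with $$\|x\|_p=\Big(\sum_{k=1}^\infty|\hat x(k)|^p\Big)^{1/p}<\infty,$$ where elements with the same coefficients $\hat x(k)$ are identified, and let $U^p_\varphi$ be its closed unit ball. Let $\psi=\{\psi_k\}_{k=1}^\infty$ be complex numbers with $\lim_{k\to\infty}|\psi_k|=0$ and $\psi_k\ne0$ for all $k$. Let $\psi U^p_\varphi$ be the set of all $F\in\mathcal X$ for which there is $f\in U^p_\varphi$ with $\hat F(k)=\psi_k\hat f(k)$ for all $k$. Let $\varepsilon_1>\varepsilon_2>\dots$ be the distinct values of $|\psi_k|$ in decreasing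 order, $g_n=\{k\in\mathbb N:|\psi_k|\ge\varepsilon_n\}$ and $\delta_n=|g_n|$ for $n\ge1$, and $g_0=\emptyset$, $\delta_0=0$. For $m\ge0$ let $$d_m(\psi U^p_\varphi)=\inf_{F_m}\ \sup_{x\in\psi U^p_\varphi}\ \inf_{u\in F_m}\|x-u\|_p,$$ where $F_m$ ranges over the $m$-dimensional linear subspaces of $\mathcal S^p_\varphi$ (Kolmogorov width), and for $n\ge1$ let $$E_n(\psi U^p_\varphi)_{\psi,p}=\sup_{f\in\psi U^p_\varphi}\ \inf_{c_k\in\mathbb C}\Big\|f-\sum_{k\in g_{n-1}}c_k\varphi_k\Big\|_p,\qquad \mathcal E_n(\psi U^p_\varphi)_{\psi,p}=\sup_{f\in\psi U^p_\varphi}\Big\|f-\sum_{k\in g_{n-1}}\hat f(k)\varphi_k\Big\|_p .$$ **Theorem 2.7.** For every $p\in[1,\infty)$ and every $n\in\mathbb N$, $n\ge1$, $$d_{\delta_{n-1}}(\psi U^p_\varphi)=d_{\delta_{n-1}+1}(\psi U^p_\varphi)=\dots=d_{\delta_n-1}(\psi U^p_\varphi)=E_n(\psi U^p_\varphi)_{\psi,p}=\mathcal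 E_n(\psi U^p_\varphi)_{\psi,p}=\varepsilon_n .$$ -/

import Mathlib

open Filter Topology
open scoped ENNReal

noncomputable section

/-- A countable linearly independent system `φ` in a complex linear space `X` (indexed here by
`ℕ` starting from `0`), together with a scalar product of the elements of `X` with the elements of
`φ`. Only the values `ip x y` for which `x` or `y` belongs to the system are
constrained (and only these are ever used). -/
structure PhiSystem (X : Type*) [AddCommGroup X] [Module ℂ X] where
  φ : ℕ → X
  linearIndependent : LinearIndependent ℂ φ
  ip : X → X → ℂ
  ip_conj_symm : ∀ x y : X, (x ∈ Set.range φ ∨ y ∈ Set.range φ) →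
    ip x y = (starRingEnd ℂ) (ip y x)
  ip_linear : ∀ (a b : ℂ) (x₁ x₂ y : X), y ∈ Set.range φ →
    ip (a • x₁ + b • x₂) y = a * ip x₁ y + b * ip x₂ y
  ip_orthonormal : ∀ k l : ℕ, ip (φ k) (φ l) = if k = l then 1 else 0

namespace PhiSystem

variable {X : Type*} [AddCommGroup X] [Module ℂ X]

/-- The Fourier coefficient of `x` with number `k`. -/
def coeff (Φ : PhiSystem X) (x : X) (k : ℕ) : ℂ := Φ.ip x (Φ.φ k)

theorem coeff_add (Φ : PhiSystem X) (x y : X) (k : ℕ) :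
    Φ.coeff (x + y) k = Φ.coeff x k + Φ.coeff y k := by
  simpa [coeff] using Φ.ip_linear 1 1 x y (Φ.φ k) ⟨k, rfl⟩

theorem coeff_smul (Φ : PhiSystem X) (a : ℂ) (x : X) (k : ℕ) :
    Φ.coeff (a • x) k = a * Φ.coeff x k := by
  simpa [coeff] using Φ.ip_linear a 0 x 0 (Φ.φ k) ⟨k, rfl⟩

theorem coeff_zero (Φ : PhiSystem X) (k : ℕ) : Φ.coeff 0 k = 0 := by
  simpa using Φ.coeff_smul 0 0 k

/-- The elements of `X` whose Fourier coefficients are `p`-summable (before identification of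
elements with the same coefficients). -/
def Sp (Φ : PhiSystem X) (p : ℝ) [hp : Fact (1 ≤ p)] : Submodule ℂ X where
  carrier := {x | Summable fun k => ‖Φ.coeff x k‖ ^ p}
  add_mem' := by
    intro x y hx hy
    have hp0 : (0 : ℝ) ≤ p := zero_le_one.trans hp.out
    refine Summable.of_nonneg_of_le (fun k => by positivity) (fun k => ?_)
      (Real.Lp_add_le_tsum_of_nonneg hp.out (fun k => norm_nonneg (Φ.coeff x k))
        (fun k => norm_nonneg (Φ.coeff y k)) hx hy).1
    rw [Φ.coeff_add]
    exact Real.rpow_le_rpow (norm_nonneg _) (norm_add_le _ _) hp0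
  zero_mem' := by
    have hp0 : p ≠ 0 := (zero_lt_one.trans_le hp.out).ne'
    simp [coeff_zero, Real.zero_rpow hp0, summable_zero]
  smul_mem' := by
    intro a x hx
    have hx' : Summable fun k => ‖Φ.coeff x k‖ ^ p := hx
    simpa [coeff_smul, Real.mul_rpow] using hx'.mul_left (‖a‖ ^ p)

variable (Φ : PhiSystem X) (p : ℝ) [hp : Fact (1 ≤ p)]

/-- `‖x‖_p = (∑ |x̂(k)|^p)^{1/p}`. -/
instance : Norm (Φ.Sp p) := ⟨fun x => (∑' k, ‖Φ.coeff (x : X) k‖ ^ p) ^ (1 / p)⟩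

theorem norm_def (x : Φ.Sp p) : ‖x‖ = (∑' k, ‖Φ.coeff (x : X) k‖ ^ p) ^ (1 / p) := rfl

theorem Sp_core : SeminormedSpace.Core ℂ (Φ.Sp p) where
  norm_nonneg x := by
    rw [norm_def]; positivity
  norm_smul a x := by
    have hp0 : p ≠ 0 := (zero_lt_one.trans_le hp.out).ne'
    simp only [norm_def, Submodule.coe_smul, coeff_smul, norm_mul,
      Real.mul_rpow (norm_nonneg _) (norm_nonneg _), tsum_mul_left]
    rw [Real.mul_rpow (by positivity) (by positivity), ← Real.rpow_mul (norm_nonneg _),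
      mul_one_div_cancel hp0, Real.rpow_one]
  norm_triangle x y := by
    have hp0 : (0 : ℝ) ≤ p := zero_le_one.trans hp.out
    have h := Real.Lp_add_le_tsum_of_nonneg hp.out (fun k => norm_nonneg (Φ.coeff (x : X) k))
        (fun k => norm_nonneg (Φ.coeff (y : X) k)) x.2 y.2
    refine le_trans ?_ h.2
    refine Real.rpow_le_rpow (by positivity) ?_ (by positivity)
    refine Summable.tsum_le_tsum (fun k => ?_) (x + y).2 h.1
    rw [Submodule.coe_add, Φ.coeff_add]
    exact Real.rpow_le_rpow (norm_nonneg _) (norm_add_le _ _) hp0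

instance : SeminormedAddCommGroup (Φ.Sp p) := SeminormedAddCommGroup.ofCore (Φ.Sp_core p)

instance : NormedSpace ℂ (Φ.Sp p) := { norm_smul_le := fun a x => ((Φ.Sp_core p).norm_smul a x).le }

/-- The normed space `𝒮^p_φ`: the elements of `Sp`, where two elements at distance `0` (that is,
with the same Fourier coefficients, see `mk_eq_mk_iff`) are identified. -/
abbrev SSpace : Type _ := SeparationQuotient (Φ.Sp p)

theorem mk_eq_mk_iff (x y : Φ.Sp p) :
    (SeparationQuotient.mk x : Φ.SSpace p) = SeparationQuotient.mk y ↔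
      ∀ k, Φ.coeff (x : X) k = Φ.coeff (y : X) k := by
  have hp0 : p ≠ 0 := (zero_lt_one.trans_le hp.out).ne'
  rw [SeparationQuotient.mk_eq_mk, Metric.inseparable_iff, dist_eq_norm, norm_def,
    Real.rpow_eq_zero (tsum_nonneg fun k => by positivity) (one_div_ne_zero hp0)]
  have hs : ∀ k, Φ.coeff ((x - y : Φ.Sp p) : X) k
      = Φ.coeff (x : X) k - Φ.coeff (y : X) k := by
    intro k
    have h : ((x - y : Φ.Sp p) : X) = (x : X) + (-1 : ℂ) • (y : X) := by
      simp [sub_eq_add_neg]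
    rw [h, coeff_add, coeff_smul]
    ring
  have hsum : Summable fun k => ‖Φ.coeff ((x - y : Φ.Sp p) : X) k‖ ^ p := (x - y).2
  rw [← hsum.hasSum_iff, hasSum_zero_iff_of_nonneg (fun k => by positivity), funext_iff]
  refine forall_congr' fun k => ?_
  simp only [Pi.zero_apply, Real.rpow_eq_zero (norm_nonneg _) hp0, norm_eq_zero, hs, sub_eq_zero]

theorem phi_mem (k : ℕ) : Φ.φ k ∈ Φ.Sp p := by
  have hp0 : p ≠ 0 := (zero_lt_one.trans_le hp.out).ne'
  refine summable_of_ne_finset_zero (s := {k}) fun l hl => ?_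
  have : k ≠ l := fun h => hl (by simp [h])
  simp [coeff, Φ.ip_orthonormal, this, Real.zero_rpow hp0]

/-- The element `φ_k` as an element of `Sp`. -/
def phi (k : ℕ) : Φ.Sp p := ⟨Φ.φ k, Φ.phi_mem p k⟩

/-- The unit ball `U^p_φ`. -/
def unitBall : Set (Φ.Sp p) := {f | ‖f‖ ≤ 1}

/-- `F` is a `ψ`-integral of `f`. -/
def IsPsiIntegral (ψ : ℕ → ℂ) (F f : X) : Prop := ∀ k, Φ.coeff F k = ψ k * Φ.coeff f k

/-- The set `ψU^p_φ` of the `ψ`-integrals of the elements of the unit ball. (For bounded `ψ` every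
`ψ`-integral `F ∈ X` of an element of `Sp` belongs to `Sp`, see `IsPsiIntegral.mem_Sp`.) -/
def psiBall (ψ : ℕ → ℂ) : Set (Φ.Sp p) :=
  {F | ∃ f ∈ Φ.unitBall p, Φ.IsPsiIntegral ψ (F : X) (f : X)}

theorem IsPsiIntegral.mem_Sp {ψ : ℕ → ℂ} {C : ℝ} (hC : ∀ k, ‖ψ k‖ ≤ C) {F f : X}
    (hf : f ∈ Φ.Sp p) (h : Φ.IsPsiIntegral ψ F f) : F ∈ Φ.Sp p := by
  have hp0 : (0 : ℝ) ≤ p := zero_le_one.trans hp.out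
  have hf' : Summable fun k => ‖Φ.coeff f k‖ ^ p := hf
  refine Summable.of_nonneg_of_le (fun k => by positivity) (fun k => ?_) (hf'.mul_left (C ^ p))
  rw [h k, norm_mul, Real.mul_rpow (norm_nonneg _) (norm_nonneg _)]
  gcongr
  exact hC k

/-- The set `ψU^p_φ` as a subset of the normed space `𝒮^p_φ`. -/
def psiBallS (ψ : ℕ → ℂ) : Set (Φ.SSpace p) := SeparationQuotient.mk '' Φ.psiBall p ψ

end PhiSystem

/-- The characteristic sequence `ε_1 > ε_2 > …` of `ψ`: the values of `|ψ_k|` in decreasing order: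
`ε_1` is the largest of them, `ε_{n+1}` the largest of those below `ε_n`. The value at `0` is
not used. -/
def charEps (ψ : ℕ → ℂ) : ℕ → ℝ
  | 0 => 0
  | 1 => sSup {t | ∃ k, ‖ψ k‖ = t}
  | n + 2 => sSup {t | (∃ k, ‖ψ k‖ = t) ∧ t < charEps ψ (n + 1)}

/-- The characteristic sequence `g_n = {k : |ψ_k| ≥ ε_n}`, `g_0 = ∅`. -/
def charSet (ψ : ℕ → ℂ) (n : ℕ) : Set ℕ :=
  if n = 0 then ∅ else {k | charEps ψ n ≤ ‖ψ k‖}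

/-- The characteristic sequence `δ_n`, the number of elements of `g_n`. -/
def charDelta (ψ : ℕ → ℂ) (n : ℕ) : ℕ := (charSet ψ n).ncard

/-- The Kolmogorov width `d_m(M; Y)`; the infimum is over the subspaces of dimension exactly `m`. -/
def kolmogorovWidth {Y : Type*} [NormedAddCommGroup Y] [NormedSpace ℂ Y] (M : Set Y) (m : ℕ) :
    ℝ≥0∞ :=
  ⨅ (F : Submodule ℂ Y) (_ : FiniteDimensional ℂ F ∧ Module.finrank ℂ F = m),
    ⨆ x ∈ M, ⨅ u : F, ‖x - (u : Y)‖ₑ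

namespace PhiSystem

variable {X : Type*} [AddCommGroup X] [Module ℂ X]

variable (Φ : PhiSystem X) (p : ℝ) [hp : Fact (1 ≤ p)]

/-- `E_n(f)_{ψ,p}`: the best approximation of `f` by polynomials with numbers in `g_{n-1}(ψ)`. -/
def bestApprox (ψ : ℕ → ℂ) (n : ℕ) (f : Φ.Sp p) : ℝ≥0∞ :=
  ⨅ c : ℕ → ℂ, ‖f - ∑ᶠ k ∈ charSet ψ (n - 1), c k • Φ.phi p k‖ₑ

/-- The deviation of `f` from its Fourier sum over `g_{n-1}(ψ)`. -/
def fourierApprox (ψ : ℕ → ℂ) (n : ℕ) (f : Φ.Sp p) : ℝ≥0∞ :=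
  ‖f - ∑ᶠ k ∈ charSet ψ (n - 1), Φ.coeff (f : X) k • Φ.phi p k‖ₑ

/-- Supremum of `bestApprox` over a set. -/
def bestApproxOn (ψ : ℕ → ℂ) (n : ℕ) (M : Set (Φ.Sp p)) : ℝ≥0∞ :=
  ⨆ f ∈ M, Φ.bestApprox p ψ n f

/-- Supremum of `fourierApprox` over a set. -/
def fourierApproxOn (ψ : ℕ → ℂ) (n : ℕ) (M : Set (Φ.Sp p)) : ℝ≥0∞ :=
  ⨆ f ∈ M, Φ.fourierApprox p ψ n f

end PhiSystem

end

/-! Upper bounds: outside `g_{n-1}` the multipliers satisfy `|ψ_k| ≤ ε_n`, so deleting any finite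
set of coordinates containing `g_{n-1}` leaves an element of `ψU` with norm at most `ε_n`
(`norm_sub_fourierSum_le`).

Lower bound for `E_n`: some `j ∉ g_{n-1}` has `|ψ_j| = ε_n`, and no polynomial over `g_{n-1}` alters
the `j`-th coefficient of `ψ_j φ_j`.

Lower bound for widths: `ψU` contains the `ε_n`-ball of the span `L` of the `φ_k`, `k ∈ g_n`
(`sum_mem_psiBall`). The Fourier projection `P` onto `L` has norm at most one, so approximating
points of `L` by `F` is no better than by `P(F)`. If `dim F < δ_n`, then `P(F)` is a proper subspace
of `L` and Riesz's lemma applies (`exists_norm_sub_ge`). The contractive projection makes a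
Borsuk-type argument unnecessary. -/

/-! ### Characteristic sequences of `ψ` -/

/-- Past some `N` all moduli lie below one admissible value, so the maximum is over finitely many
indices. A general `P` covers both the first value and the recursive step of `charEps`. -/
theorem exists_isGreatest_norm_of_tendsto_zero {ψ : ℕ → ℂ}
    (hlim : Tendsto (fun k => ‖ψ k‖) atTop (𝓝 0)) (hne : ∀ k, ψ k ≠ 0)
    {P : ℝ → Prop} (hP : ∃ k, P ‖ψ k‖) :
    ∃ a, IsGreatest {t | (∃ k, ‖ψ k‖ = t) ∧ P t} a := by
  obtain ⟨k, hk⟩ := hP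
  have hpos : 0 < ‖ψ k‖ := norm_pos_iff.2 (hne k)
  obtain ⟨N, hN⟩ := eventually_atTop.1 (hlim.eventually (gt_mem_nhds hpos))
  classical
  let s := (Finset.range (N + k + 1)).filter fun j => P ‖ψ j‖
  have hks : k ∈ s := by simp only [s, Finset.mem_filter, Finset.mem_range]; exact ⟨by omega, hk⟩
  obtain ⟨j, hj, hmax⟩ := s.exists_max_image (fun j => ‖ψ j‖) ⟨k, hks⟩
  refine ⟨‖ψ j‖, ⟨⟨j, rfl⟩, (Finset.mem_filter.1 hj).2⟩, ?_⟩
  rintro _ ⟨⟨i, rfl⟩, hi⟩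
  by_cases hiN : N ≤ i
  · exact (hN i hiN).le.trans (hmax k hks)
  · refine hmax i ?_
    simp only [s, Finset.mem_filter, Finset.mem_range]
    exact ⟨by omega, hi⟩

theorem isGreatest_charEps {ψ : ℕ → ℂ}
    (hlim : Tendsto (fun k => ‖ψ k‖) atTop (𝓝 0)) (hne : ∀ k, ψ k ≠ 0) (n : ℕ) :
    -- The guard `n ≠ 0` treats the dummy value `charEps ψ 0 = 0` as no upper constraint.
    IsGreatest {t | (∃ k, ‖ψ k‖ = t) ∧ (n ≠ 0 → t < charEps ψ n)} (charEps ψ (n + 1)) := by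
  induction n with
  | zero =>
    obtain ⟨a, ha⟩ := exists_isGreatest_norm_of_tendsto_zero hlim hne (P := fun _ => True) ⟨0, trivial⟩
    simp only [and_true] at ha
    simpa [charEps, ha.csSup_eq] using ha
  | succ n ih =>
    obtain ⟨⟨j, hj⟩, -⟩ := ih.1
    have hpos : 0 < charEps ψ (n + 1) := hj ▸ norm_pos_iff.2 (hne j)
    obtain ⟨a, ha⟩ := exists_isGreatest_norm_of_tendsto_zero hlim hne
      (P := fun t => t < charEps ψ (n + 1)) (hlim.eventually (gt_mem_nhds hpos)).exists
    have h2 : charEps ψ (n + 1 + 1) = a := by rw [← ha.csSup_eq]; rfl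
    simpa [h2] using ha

theorem exists_norm_eq_charEps {ψ : ℕ → ℂ}
    (hlim : Tendsto (fun k => ‖ψ k‖) atTop (𝓝 0)) (hne : ∀ k, ψ k ≠ 0) (n : ℕ) :
    ∃ k, ‖ψ k‖ = charEps ψ (n + 1) := (isGreatest_charEps hlim hne n).1.1

theorem charEps_pos {ψ : ℕ → ℂ}
    (hlim : Tendsto (fun k => ‖ψ k‖) atTop (𝓝 0)) (hne : ∀ k, ψ k ≠ 0) (n : ℕ) :
    0 < charEps ψ (n + 1) := by
  obtain ⟨k, hk⟩ := exists_norm_eq_charEps hlim hne n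
  exact hk ▸ norm_pos_iff.2 (hne k)

theorem notMem_charSet_iff {ψ : ℕ → ℂ} {n k : ℕ} :
    k ∉ charSet ψ n ↔ (n ≠ 0 → ‖ψ k‖ < charEps ψ n) := by
  by_cases h : n = 0 <;> simp [charSet, h]

theorem norm_le_charEps_of_notMem {ψ : ℕ → ℂ}
    (hlim : Tendsto (fun k => ‖ψ k‖) atTop (𝓝 0)) (hne : ∀ k, ψ k ≠ 0) {n k : ℕ}
    (hk : k ∉ charSet ψ n) : ‖ψ k‖ ≤ charEps ψ (n + 1) :=
  (isGreatest_charEps hlim hne n).2 ⟨⟨k, rfl⟩, notMem_charSet_iff.1 hk⟩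

theorem charSet_subset_succ {ψ : ℕ → ℂ}
    (hlim : Tendsto (fun k => ‖ψ k‖) atTop (𝓝 0)) (hne : ∀ k, ψ k ≠ 0) (n : ℕ) :
    charSet ψ n ⊆ charSet ψ (n + 1) := by
  by_cases hn : n = 0
  · simp [charSet, hn]
  · intro k hk
    simp only [charSet, hn, if_false, Nat.add_eq_zero_iff, one_ne_zero, and_false,
      Set.mem_ofPred_eq] at hk ⊢
    exact ((isGreatest_charEps hlim hne n).1.2 hn).le.trans hk

theorem finite_charSet {ψ : ℕ → ℂ}
    (hlim : Tendsto (fun k => ‖ψ k‖) atTop (𝓝 0)) (hne : ∀ k, ψ k ≠ 0) (n : ℕ) :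
    (charSet ψ n).Finite := by
  rcases n with _ | n
  · simp [charSet]
  · obtain ⟨N, hN⟩ := eventually_atTop.1
      (hlim.eventually (gt_mem_nhds (charEps_pos hlim hne n)))
    refine (Set.finite_lt_nat N).subset fun k hk => ?_
    by_contra hkN
    exact notMem_charSet_iff.2 (fun _ => hN k (not_lt.1 hkN)) hk

/-! ### Coefficient functionals and Fourier projections -/

namespace PhiSystem

variable {X : Type*} [AddCommGroup X] [Module ℂ X] (Φ : PhiSystem X) (p : ℝ) [hp : Fact (1 ≤ p)]

/-- The Fourier coefficient as a linear functional on `Sp`. -/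
def coeffₗ (k : ℕ) : Φ.Sp p →ₗ[ℂ] ℂ where
  toFun x := Φ.coeff (x : X) k
  map_add' _ _ := Φ.coeff_add _ _ k
  map_smul' a _ := Φ.coeff_smul a _ k

variable {Φ p}

theorem coeffₗ_apply (k : ℕ) (x : Φ.Sp p) : Φ.coeffₗ p k x = Φ.coeff (x : X) k := rfl

theorem coeffₗ_phi (k l : ℕ) : Φ.coeffₗ p l (Φ.phi p k) = if k = l then 1 else 0 :=
  Φ.ip_orthonormal k l

theorem coeffₗ_sum (s : Finset ℕ) (c : ℕ → ℂ) (l : ℕ) :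
    Φ.coeffₗ p l (∑ k ∈ s, c k • Φ.phi p k) = if l ∈ s then c l else 0 := by
  simp [coeffₗ_phi]

/-- The norm is monotone in the moduli of the coefficients; the later norm estimates reduce to this
comparison. -/
theorem norm_le_mul_of_coeff_le {x y : Φ.Sp p} {A : ℝ} (hA : 0 ≤ A)
    (h : ∀ k, ‖Φ.coeffₗ p k x‖ ≤ A * ‖Φ.coeffₗ p k y‖) : ‖x‖ ≤ A * ‖y‖ := by
  have hp0 : 0 < p := zero_lt_one.trans_le hp.out
  have hA' : ‖((A : ℂ) • y)‖ = A * ‖y‖ := by rw [(Φ.Sp_core p).norm_smul]; simp [abs_of_nonneg hA]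
  rw [← hA', norm_def, norm_def]
  refine Real.rpow_le_rpow (tsum_nonneg fun k => by positivity) ?_ (by positivity)
  refine Summable.tsum_le_tsum (fun k => ?_) x.2 ((A : ℂ) • y).2
  refine Real.rpow_le_rpow (norm_nonneg _) ?_ hp0.le
  have := h k
  rwa [← coeffₗ_apply, ← coeffₗ_apply, map_smul, norm_smul, Complex.norm_real, Real.norm_of_nonneg hA]

theorem norm_phi (k : ℕ) : ‖Φ.phi p k‖ = 1 := by
  have hp0 : p ≠ 0 := (zero_lt_one.trans_le hp.out).ne'
  rw [norm_def, tsum_eq_single k]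
  · simp [phi, coeff, Φ.ip_orthonormal]
  · intro l hl
    simp [phi, coeff, Φ.ip_orthonormal, hl.symm, Real.zero_rpow hp0]

theorem norm_coeffₗ_le (k : ℕ) (x : Φ.Sp p) : ‖Φ.coeffₗ p k x‖ ≤ ‖x‖ := by
  have h : ‖Φ.coeffₗ p k x • Φ.phi p k‖ ≤ 1 * ‖x‖ := by
    refine norm_le_mul_of_coeff_le zero_le_one fun l => ?_
    rw [map_smul, coeffₗ_phi]
    by_cases hl : k = l <;> simp [hl]
  rwa [(Φ.Sp_core p).norm_smul, norm_phi, mul_one, one_mul] at h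

theorem coeffₗ_eq_of_mk_eq {x y : Φ.Sp p}
    (h : (SeparationQuotient.mk x : Φ.SSpace p) = SeparationQuotient.mk y) (k : ℕ) :
    Φ.coeffₗ p k x = Φ.coeffₗ p k y := (Φ.mk_eq_mk_iff p x y).1 h k

theorem mk_eq_of_coeffₗ_eq {x y : Φ.Sp p} (h : ∀ k, Φ.coeffₗ p k x = Φ.coeffₗ p k y) :
    (SeparationQuotient.mk x : Φ.SSpace p) = SeparationQuotient.mk y :=
  (Φ.mk_eq_mk_iff p x y).2 h

theorem mk_sum_smul_phi (s : Finset ℕ) (c : ℕ → ℂ) :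
    (SeparationQuotient.mk (∑ k ∈ s, c k • Φ.phi p k) : Φ.SSpace p) =
      ∑ k ∈ s, c k • (SeparationQuotient.mk (Φ.phi p k) : Φ.SSpace p) :=
  map_sum (SeparationQuotient.mkCLM ℂ (Φ.Sp p)) (fun k => c k • Φ.phi p k) s

variable (Φ p) in
/-- The Fourier sum over a finite set of indices, as a linear map on `𝒮^p_φ`. -/
noncomputable def fourierProj (s : Finset ℕ) : Φ.SSpace p →ₗ[ℂ] Φ.SSpace p :=
  (SeparationQuotient.mkCLM ℂ (Φ.Sp p)).toLinearMap ∘ₗ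
    (∑ k ∈ s, (Φ.coeffₗ p k).smulRight (Φ.phi p k)) ∘ₗ
    (SeparationQuotient.outCLM ℂ (Φ.Sp p)).toLinearMap

/-- The representative chosen by `outCLM` is immaterial, since identified elements share their
coefficients. -/
theorem fourierProj_mk (s : Finset ℕ) (x : Φ.Sp p) :
    Φ.fourierProj p s (SeparationQuotient.mk x) =
      SeparationQuotient.mk (∑ k ∈ s, Φ.coeffₗ p k x • Φ.phi p k) := by
  have h : ∀ k, Φ.coeffₗ p k (SeparationQuotient.outCLM ℂ (Φ.Sp p) (SeparationQuotient.mk x)) =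
      Φ.coeffₗ p k x := coeffₗ_eq_of_mk_eq (SeparationQuotient.mk_outCLM _ _)
  simp [fourierProj, h, mk_sum_smul_phi]

theorem norm_fourierProj_le (s : Finset ℕ) (y : Φ.SSpace p) : ‖Φ.fourierProj p s y‖ ≤ ‖y‖ := by
  obtain ⟨x, rfl⟩ := SeparationQuotient.surjective_mk y
  rw [fourierProj_mk, SeparationQuotient.norm_mk, SeparationQuotient.norm_mk, ← one_mul ‖x‖]
  refine norm_le_mul_of_coeff_le zero_le_one fun l => ?_
  rw [coeffₗ_sum]
  split_ifs <;> simp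

theorem fourierProj_fourierProj (s : Finset ℕ) (y : Φ.SSpace p) :
    Φ.fourierProj p s (Φ.fourierProj p s y) = Φ.fourierProj p s y := by
  obtain ⟨x, rfl⟩ := SeparationQuotient.surjective_mk y
  rw [fourierProj_mk, fourierProj_mk]
  refine mk_eq_of_coeffₗ_eq fun l => ?_
  simp only [coeffₗ_sum]
  split_ifs <;> rfl

theorem linearIndependent_mk_phi :
    LinearIndependent ℂ fun k => (SeparationQuotient.mk (Φ.phi p k) : Φ.SSpace p) := by
  rw [linearIndependent_iff']
  intro s c hc l hl
  have h : (SeparationQuotient.mk (∑ k ∈ s, c k • Φ.phi p k) : Φ.SSpace p) =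
      SeparationQuotient.mk 0 := by
    rw [mk_sum_smul_phi, hc, SeparationQuotient.mk_zero]
  have h' := coeffₗ_eq_of_mk_eq h l
  rwa [coeffₗ_sum, if_pos hl, map_zero] at h'

theorem finrank_span_mk_phi (s : Finset ℕ) :
    Module.finrank ℂ (Submodule.span ℂ
      ((fun k => (SeparationQuotient.mk (Φ.phi p k) : Φ.SSpace p)) '' s)) = s.card := by
  have h := finrank_span_eq_card (R := ℂ)
    ((linearIndependent_mk_phi (Φ := Φ) (p := p)).comp ((↑) : s → ℕ) Subtype.val_injective)
  rw [Set.range_comp, Subtype.range_coe_subtype] at h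
  simpa using h

theorem range_fourierProj (s : Finset ℕ) :
    LinearMap.range (Φ.fourierProj p s) = Submodule.span ℂ
      ((fun k => (SeparationQuotient.mk (Φ.phi p k) : Φ.SSpace p)) '' s) := by
  apply le_antisymm
  · rintro _ ⟨y, rfl⟩
    obtain ⟨x, rfl⟩ := SeparationQuotient.surjective_mk y
    rw [fourierProj_mk]
    rw [mk_sum_smul_phi]
    exact Submodule.sum_mem _ fun k hk =>
      Submodule.smul_mem _ _ (Submodule.subset_span ⟨k, hk, rfl⟩)
  · rw [Submodule.span_le]
    rintro _ ⟨k, hk, rfl⟩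
    refine ⟨SeparationQuotient.mk (Φ.phi p k), ?_⟩
    rw [fourierProj_mk]
    refine mk_eq_of_coeffₗ_eq fun l => ?_
    simp only [coeffₗ_sum, coeffₗ_phi]
    split_ifs with h1 h2 h2 <;> simp_all

/-! ### Balls inside `ψU^p_φ` and deviations of Fourier sums -/

/-- Polynomials of norm at most `ε` over indices with `ε ≤ |ψ_k|` belong to `ψU^p_φ`. -/
theorem sum_mem_psiBall {ψ : ℕ → ℂ} (hne : ∀ k, ψ k ≠ 0) {ε : ℝ} (hε : 0 < ε) {s : Finset ℕ}
    (hs : ∀ k ∈ s, ε ≤ ‖ψ k‖) (c : ℕ → ℂ) (hc : ‖∑ k ∈ s, c k • Φ.phi p k‖ ≤ ε) :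
    ∑ k ∈ s, c k • Φ.phi p k ∈ Φ.psiBall p ψ := by
  -- Dividing by `ψ_k` enlarges each coefficient by a factor at most `ε⁻¹`.
  refine ⟨∑ k ∈ s, (c k / ψ k) • Φ.phi p k, ?_, fun l => ?_⟩
  · have h : ‖∑ k ∈ s, (c k / ψ k) • Φ.phi p k‖ ≤ ε⁻¹ * ‖∑ k ∈ s, c k • Φ.phi p k‖ := by
      refine norm_le_mul_of_coeff_le (inv_nonneg.2 hε.le) fun l => ?_
      simp only [coeffₗ_sum]
      split_ifs with hl
      · rw [norm_div, div_eq_inv_mul]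
        gcongr
        exact hs l hl
      · simp
    calc _ ≤ _ := h
      _ ≤ ε⁻¹ * ε := by gcongr
      _ = 1 := inv_mul_cancel₀ hε.ne'
  · have h1 := coeffₗ_sum (Φ := Φ) (p := p) s c l
    have h2 := coeffₗ_sum (Φ := Φ) (p := p) s (fun k => c k / ψ k) l
    rw [coeffₗ_apply] at h1 h2
    rw [h1, h2]
    split_ifs
    · rw [mul_div_cancel₀ _ (hne l)]
    · simp

theorem norm_sub_fourierSum_le {ψ : ℕ → ℂ} {ε : ℝ} (hε : 0 ≤ ε) {s : Finset ℕ}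
    (hs : ∀ k ∉ s, ‖ψ k‖ ≤ ε) {F : Φ.Sp p} (hF : F ∈ Φ.psiBall p ψ) :
    ‖F - ∑ k ∈ s, Φ.coeffₗ p k F • Φ.phi p k‖ ≤ ε := by
  obtain ⟨f, hf, h⟩ := hF
  calc _ ≤ ε * ‖f‖ := by
        refine norm_le_mul_of_coeff_le hε fun l => ?_
        rw [map_sub, coeffₗ_sum]
        split_ifs with hl
        · simpa using by positivity
        · rw [sub_zero, coeffₗ_apply, h l, norm_mul, coeffₗ_apply]
          gcongr
          exact hs l hl
    _ ≤ ε * 1 := by gcongr; exact hf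
    _ = ε := mul_one ε

/-- The unit ball of a coordinate subspace of dimension larger than `dim F` is not approximated
by `F` better than by `0`: apply Riesz's lemma to the projection of `F`. -/
theorem exists_norm_sub_ge (s : Finset ℕ) (F : Submodule ℂ (Φ.SSpace p)) [FiniteDimensional ℂ F]
    (hF : Module.finrank ℂ F < s.card) {r : ℝ} (hr : r < 1) {ε : ℝ} (hε : 0 < ε) :
    ∃ z ∈ LinearMap.range (Φ.fourierProj p s), ‖z‖ = ε ∧ ∀ u ∈ F, r * ε ≤ ‖z - u‖ := by
  set L := LinearMap.range (Φ.fourierProj p s) with hL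
  have hLrank : Module.finrank ℂ L = s.card := by
    rw [hL, range_fourierProj, finrank_span_mk_phi]
  have hle : F.map (Φ.fourierProj p s) ≤ L := LinearMap.map_le_range
  let G : Submodule ℂ L := (F.map (Φ.fourierProj p s)).submoduleOf L
  have : FiniteDimensional ℂ L := Module.finite_of_finrank_pos (by omega)
  -- The image of `F` has dimension at most `dim F < dim L`, so it cannot fill `L`.
  have hex : ∃ x : L, x ∉ G := by
    by_contra! hcon
    have : L ≤ F.map (Φ.fourierProj p s) := fun x hx => hcon ⟨x, hx⟩
    have h1 := Submodule.finrank_mono this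
    have h2 := Submodule.finrank_map_le (Φ.fourierProj p s) F
    omega
  obtain ⟨x, hxG, hx⟩ := riesz_lemma (F := G) G.closed_of_finiteDimensional hex hr
  have hx0 : 0 < ‖x‖ := norm_pos_iff.2 fun h => hxG (h ▸ G.zero_mem)
  set a : ℂ := ((ε / ‖x‖ : ℝ) : ℂ)
  have ha : ‖a‖ = ε / ‖x‖ := by simp [a, abs_of_pos hε]
  have ha0 : a ≠ 0 := norm_pos_iff.1 (by rw [ha]; positivity)
  refine ⟨a • (x : Φ.SSpace p), L.smul_mem _ x.2, ?_, fun u hu => ?_⟩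
  · rw [norm_smul, ha, Submodule.coe_norm, div_mul_cancel₀]
    exact hx0.ne'
  · have hxQ : Φ.fourierProj p s x = x := by
      obtain ⟨y, hy⟩ := x.2
      rw [← hy, fourierProj_fourierProj]
    have hv : Φ.fourierProj p s (a⁻¹ • u) ∈ F.map (Φ.fourierProj p s) :=
      Submodule.mem_map_of_mem (F.smul_mem _ hu)
    have h1 := hx ⟨_, hle hv⟩ hv
    have h2 : a • (x : Φ.SSpace p) - u = a • (x - a⁻¹ • u) := by
      rw [smul_sub, smul_inv_smul₀ ha0]
    -- The projection fixes `x` and does not increase norms, so projecting the approximant onto `L`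
    -- cannot increase the distance.
    have h3 : ‖(x : Φ.SSpace p) - Φ.fourierProj p s (a⁻¹ • u)‖ ≤ ‖(x : Φ.SSpace p) - a⁻¹ • u‖ := by
      have := norm_fourierProj_le s ((x : Φ.SSpace p) - a⁻¹ • u)
      rwa [map_sub, hxQ] at this
    rw [h2, norm_smul, ha]
    calc r * ε = ε / ‖x‖ * (r * ‖x‖) := by field_simp
      _ ≤ _ := by gcongr; exact h1.trans h3

/-! ### Bounds for the widths and the approximation quantities -/

theorem le_kolmogorovWidth {ψ : ℕ → ℂ} (hne : ∀ k, ψ k ≠ 0) {ε : ℝ} (hε : 0 < ε) {s : Finset ℕ}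
    (hs : ∀ k ∈ s, ε ≤ ‖ψ k‖) {m : ℕ} (hm : m < s.card) :
    ENNReal.ofReal ε ≤ kolmogorovWidth (Φ.psiBallS p ψ) m := by
  refine le_iInf₂ fun F hF => ?_
  have := hF.1
  -- Riesz's lemma loses a factor `r < 1`; it is recovered by letting `r → 1`.
  have key : ∀ r < 1, ENNReal.ofReal (r * ε) ≤ ⨆ x ∈ Φ.psiBallS p ψ, ⨅ u : F, ‖x - u‖ₑ := by
    intro r hr
    obtain ⟨z, ⟨y, hy⟩, hz, hzF⟩ := exists_norm_sub_ge s F (hF.2 ▸ hm) hr hε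
    obtain ⟨x, rfl⟩ := SeparationQuotient.surjective_mk y
    rw [fourierProj_mk] at hy
    have hmem : z ∈ Φ.psiBallS p ψ := by
      refine ⟨_, sum_mem_psiBall hne hε hs _ ?_, hy⟩
      rw [← SeparationQuotient.norm_mk, hy, hz]
    refine le_iSup₂_of_le z hmem (le_iInf fun u => ?_)
    rw [← ofReal_norm]
    exact ENNReal.ofReal_le_ofReal (hzF u u.2)
  have hlim : Tendsto (fun r : ℝ => ENNReal.ofReal (r * ε)) (𝓝[<] 1) (𝓝 (ENNReal.ofReal (1 * ε))) :=
    ((ENNReal.continuous_ofReal.comp (continuous_id.mul continuous_const)).tendsto 1).mono_left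
      nhdsWithin_le_nhds
  rw [one_mul] at hlim
  exact le_of_tendsto hlim (eventually_nhdsWithin_of_forall fun r hr => key r hr)

theorem kolmogorovWidth_le {ψ : ℕ → ℂ} {ε : ℝ} (hε : 0 ≤ ε) {s : Finset ℕ}
    (hs : ∀ k ∉ s, ‖ψ k‖ ≤ ε) :
    kolmogorovWidth (Φ.psiBallS p ψ) s.card ≤ ENNReal.ofReal ε := by
  refine iInf₂_le_of_le (LinearMap.range (Φ.fourierProj p s)) ⟨?_, ?_⟩ (iSup₂_le ?_)
  · rw [range_fourierProj]
    exact FiniteDimensional.span_of_finite ℂ (s.finite_toSet.image _)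
  · rw [range_fourierProj, finrank_span_mk_phi]
  · rintro _ ⟨F, hF, rfl⟩
    refine iInf_le_of_le ⟨_, LinearMap.mem_range_self _ (SeparationQuotient.mk F)⟩ ?_
    change ‖SeparationQuotient.mk F - Φ.fourierProj p s (SeparationQuotient.mk F)‖ₑ ≤ _
    rw [fourierProj_mk, ← SeparationQuotient.mk_sub, ← ofReal_norm, SeparationQuotient.norm_mk]
    exact ENNReal.ofReal_le_ofReal (norm_sub_fourierSum_le hε hs hF)

theorem bestApproxOn_le_fourierApproxOn (ψ : ℕ → ℂ) (n : ℕ) (M : Set (Φ.Sp p)) :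
    Φ.bestApproxOn p ψ n M ≤ Φ.fourierApproxOn p ψ n M :=
  iSup₂_mono fun f _ => iInf_le _ (Φ.coeff (f : X))

theorem fourierApproxOn_le {ψ : ℕ → ℂ} (hlim : Tendsto (fun k => ‖ψ k‖) atTop (𝓝 0))
    (hne : ∀ k, ψ k ≠ 0) (n : ℕ) :
    Φ.fourierApproxOn p ψ (n + 1) (Φ.psiBall p ψ) ≤ ENNReal.ofReal (charEps ψ (n + 1)) := by
  refine iSup₂_le fun F hF => ?_
  obtain ⟨s, hs⟩ := (finite_charSet hlim hne n).exists_finset_coe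
  rw [fourierApprox, Nat.add_sub_cancel, ← hs, finsum_mem_coe_finset, ← ofReal_norm]
  refine ENNReal.ofReal_le_ofReal (norm_sub_fourierSum_le (charEps_pos hlim hne n).le ?_ hF)
  intro k hk
  exact norm_le_charEps_of_notMem hlim hne (by rwa [← hs, Finset.mem_coe])

theorem le_bestApproxOn {ψ : ℕ → ℂ} (hlim : Tendsto (fun k => ‖ψ k‖) atTop (𝓝 0))
    (hne : ∀ k, ψ k ≠ 0) (n : ℕ) :
    ENNReal.ofReal (charEps ψ (n + 1)) ≤ Φ.bestApproxOn p ψ (n + 1) (Φ.psiBall p ψ) := by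
  obtain ⟨s, hs⟩ := (finite_charSet hlim hne n).exists_finset_coe
  obtain ⟨⟨j, hj⟩, hlt⟩ := (isGreatest_charEps hlim hne n).1
  have hjs : j ∉ s := by
    rw [← Finset.mem_coe, hs, notMem_charSet_iff, hj]
    exact hlt
  -- The extremal element is `ψ_j φ_j`, a `ψ`-integral of `φ_j`.
  have hmem : ∑ k ∈ {j}, ψ k • Φ.phi p k ∈ Φ.psiBall p ψ := by
    refine sum_mem_psiBall hne (norm_pos_iff.2 (hne j)) (by simp) ψ ?_
    rw [Finset.sum_singleton, (Φ.Sp_core p).norm_smul, norm_phi, mul_one]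
  refine le_iSup₂_of_le _ hmem (le_iInf fun c => ?_)
  rw [Nat.add_sub_cancel, ← hs, finsum_mem_coe_finset, ← ofReal_norm]
  refine ENNReal.ofReal_le_ofReal ?_
  have h := norm_coeffₗ_le j (∑ k ∈ {j}, ψ k • Φ.phi p k - ∑ k ∈ s, c k • Φ.phi p k)
  rw [map_sub, coeffₗ_sum, coeffₗ_sum, if_neg hjs, if_pos (Finset.mem_singleton_self j),
    sub_zero, hj] at h
  exact h

end PhiSystem

theorem theorem2p7 {X : Type*} [AddCommGroup X] [Module ℂ X] (Φ : PhiSystem X)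
    (p : ℝ) [Fact (1 ≤ p)] (ψ : ℕ → ℂ)
    (hψ_lim : Tendsto (fun k => ‖ψ k‖) atTop (𝓝 0)) (hψ_ne : ∀ k, ψ k ≠ 0)
    (n : ℕ) (hn : 1 ≤ n) :
    (∀ m : ℕ, charDelta ψ (n - 1) ≤ m → m < charDelta ψ n →
      kolmogorovWidth (Φ.psiBallS p ψ) m = ENNReal.ofReal (charEps ψ n)) ∧
    Φ.bestApproxOn p ψ n (Φ.psiBall p ψ) = ENNReal.ofReal (charEps ψ n) ∧
    Φ.fourierApproxOn p ψ n (Φ.psiBall p ψ) = ENNReal.ofReal (charEps ψ n) := by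
  obtain ⟨n, rfl⟩ := Nat.exists_eq_add_of_le' hn
  rw [Nat.add_sub_cancel]
  have hpos := charEps_pos hψ_lim hψ_ne n
  have h1 := Φ.le_bestApproxOn (p := p) hψ_lim hψ_ne n
  have h2 := Φ.bestApproxOn_le_fourierApproxOn (p := p) ψ (n + 1) (Φ.psiBall p ψ)
  have h3 := Φ.fourierApproxOn_le (p := p) hψ_lim hψ_ne n
  refine ⟨fun m hm hm' => ?_, le_antisymm (h2.trans h3) h1, le_antisymm h3 (h1.trans h2)⟩
  obtain ⟨s, hs⟩ := (finite_charSet hψ_lim hψ_ne n).exists_finset_coe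
  obtain ⟨t, ht⟩ := (finite_charSet hψ_lim hψ_ne (n + 1)).exists_finset_coe
  have hst : s ⊆ t := by
    rw [← Finset.coe_subset, hs, ht]
    exact charSet_subset_succ hψ_lim hψ_ne n
  rw [charDelta, ← hs, Set.ncard_coe_finset] at hm
  rw [charDelta, ← ht, Set.ncard_coe_finset] at hm'
  apply le_antisymm
  -- The width requires dimension exactly `m`, so `g_{n-1}` is padded to an `m`-element set inside
  -- `g_n`; extra coordinates do not spoil the bound.
  · obtain ⟨q, hsq, -, rfl⟩ := Finset.exists_subsuperset_card_eq hst hm hm'.le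
    refine Φ.kolmogorovWidth_le hpos.le fun k hk => ?_
    refine norm_le_charEps_of_notMem hψ_lim hψ_ne ?_
    rw [← hs, Finset.mem_coe]
    exact fun h => hk (hsq h)
  · refine Φ.le_kolmogorovWidth hψ_ne hpos (fun k hk => ?_) hm'
    have hk' : k ∈ charSet ψ (n + 1) := by rwa [← ht, Finset.mem_coe]
    simpa [charSet] using hk'
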